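/- Let $K$ be a field of characteristic zero (for instance $\mathbb{R}$ or $\mathbb{C}$) and let $\beta\in K$, $\beta\ne 0$. Consider the discrete equation on the square lattice $$\Phi_{n,m}:=(u_{n,m+1}+1)(u_{n,m}-1)-\beta(u_{n+1,m+1}-1)(u_{n+1,m}+1)=0,\qquad n,m\in\mathbb{Z}.\tag{E}$$ For families $h=(h_{n,m})_{n,m\in\mathbb Z}$ of polynomials over $K$ in the variables $u_{i,j}$ $(i,j\in\mathbb Z)$, let $D_h=\sum_{i,j}h_{i,j}\,\partial/\partial u_{i,j}$ and $[g,f]_{n,m}=D_g f_{n,m}-D_f g_{n,m}$. Put $$g_{n,m}=(u_{n,m}^2-1)\big((m+1)u_{n,m+1}-(m-1)u_{n,m-1}\big),\qquad f^{(1)}_{n,m}=(u_{n,m}^2-1)(u_{n,m+1}-u_{n,m-1}),$$ and define the modified Volterra hierarchy by $f^{(k+1)}=[g,f^{(k)}]$ for $k\ge1$. Let the constants $c_{k,j}$ be defined by $$c_{1,0}=1,\qquad c_{k,-1}=c_{k,k}=0,\qquad c_{k+1,j}=c_{k,j}-k\,c_{k,j-1}\quad(0\le j\le k,\ k\ge1).$$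 An equation $\partial_t u_{n,m}=h_{n,m}$, where each polynomial $h_{n,m}$ involves only $u_{n,m+\mu},u_{n,m+\mu-1},\dots,u_{n,m-\mu}$ for some $\mu>0$, is called a generalized symmetry of order $\mu$ in the $m$-direction of (E) if $\partial h_{n_1,m_1}/\partial u_{n_1,m_1+\mu}\ne0$ for some $n_1,m_1$, $\partial h_{n_2,m_2}/\partial u_{n_2,m_2-\mu}\ne0$ for some $n_2,m_2$, and, for all $n,m$, $$\sum_{i,j\in\{0,1\}}h_{n+i,m+j}\,\frac{\partial\Phi_{n,m}}{\partial u_{n+i,m+j}}=0$$ holds on every solution $u:\mathbb{Z}^2\to K$ of (E). Theorem. For every $k\ge1$, $$\partial_{t_k}u_{n,m}=\beta^{nk}\sum_{j=0}^{k-1}4^j c_{k,j}f^{(k-j)}_{n,m}$$ is a generalized symmetry of order $k$ in the $m$-direction of (E). It does not depend explicitly on $m$, and its explicit dependence on $n$ is given by the multiplier $\beta^{nk}$ only: there is a polynomial $S_k$ over $K$ in variables $x_j$ $(j\in\mathbb Z)$, independent of $n$ and $m$, such that $\sum_{j=0}^{k-1}4^j c_{k,j}f^{(k-j)}_{n,m}$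 is obtained from $S_k$ by substituting $u_{n,m+j}$ for $x_j$, for all $n,m\in\mathbb{Z}$. -/

import Mathlib

open MvPolynomial

noncomputable section

/-- Polynomials in the lattice variables `u_{n,m}`; the variable `u_{n,m}` is `X (n, m)`. -/
abbrev LatticePoly (K : Type*) [Field K] : Type _ := MvPolynomial (ℤ × ℤ) K

/-- A family `h_{n,m}` of polynomials in the lattice variables, indexed by the lattice point.
It is the right-hand side of the differential-difference equation `∂_t u_{n,m} = h_{n,m}`.
It may depend on `n` and `m` explicitly as well as through the variables. -/
abbrev LatticeField (K : Type*) [Field K] : Type _ := ℤ → ℤ → LatticePoly K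

/-- Total derivative in virtue of `∂_t u_{n,m} = h_{n,m}`: the derivation
`p ↦ ∑ h_{i,j} ∂p/∂u_{i,j}`, the sum being over all lattice points `(i, j)`. -/
def totalDeriv {K : Type*} [Field K] (h : LatticeField K) :
    Derivation K (LatticePoly K) (LatticePoly K) :=
  mkDerivation K fun v : ℤ × ℤ => h v.1 v.2

/-- `[g, f]_{n,m} = D_g f_{n,m} - D_f g_{n,m}`. -/
def lieBracket {K : Type*} [Field K] (g f : LatticeField K) : LatticeField K :=
  fun n m => totalDeriv g (f n m) - totalDeriv f (g n m)

/-- The modified Volterra equation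
`f⁽¹⁾_{n,m} = (u_{n,m}² - 1)(u_{n,m+1} - u_{n,m-1})`. -/
def modifiedVolterra (K : Type*) [Field K] : LatticeField K :=
  fun n m => (X (n, m) ^ 2 - 1) * (X (n, m + 1) - X (n, m - 1))

/-- Its master symmetry
`g_{n,m} = (u_{n,m}² - 1)((m + 1) u_{n,m+1} - (m - 1) u_{n,m-1})`. -/
def masterSymmetry (K : Type*) [Field K] : LatticeField K :=
  fun n m => (X (n, m) ^ 2 - 1) *
    (C ((m : K) + 1) * X (n, m + 1) - C ((m : K) - 1) * X (n, m - 1))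

/-- The modified Volterra hierarchy `f⁽ᵏ⁾`, `k ≥ 1`, with `f⁽ᵏ⁺¹⁾ = [g, f⁽ᵏ⁾]`.
The value at `k = 0` is a dummy. -/
def volterraHierarchy (K : Type*) [Field K] : ℕ → LatticeField K
  | 0 => fun _ _ => 0
  | 1 => modifiedVolterra K
  | k + 2 => lieBracket (masterSymmetry K) (volterraHierarchy K (k + 1))

/-- The integers `c_{k,j}`, `k ≥ 1`, `0 ≤ j ≤ k`, with `c_{1,0} = 1`, `c_{k,-1} = c_{k,k} = 0` and
`c_{k+1,j} = c_{k,j} - k c_{k,j-1}`. The values for `k = 0` are dummies. -/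
def symCoeff : ℕ → ℕ → ℤ
  | 0, _ => 0
  | 1, 0 => 1
  | 1, _ + 1 => 0
  | k + 2, 0 => symCoeff (k + 1) 0
  | k + 2, j + 1 => symCoeff (k + 1) (j + 1) - ((k : ℤ) + 1) * symCoeff (k + 1) j

/-- The boundary condition `c_{k,k} = 0` holds (also beyond the diagonal). -/
theorem symCoeff_eq_zero_of_le : ∀ k j : ℕ, k ≤ j → symCoeff k j = 0
  | 0, _, _ => by simp [symCoeff]
  | 1, 0, h => by omega
  | 1, _ + 1, _ => by simp [symCoeff]
  | k + 2, 0, h => by omega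
  | k + 2, j + 1, h => by
      rw [symCoeff, symCoeff_eq_zero_of_le (k + 1) (j + 1) (by omega),
        symCoeff_eq_zero_of_le (k + 1) j (by omega)]
      simp

/-- The combination `∑_{j=0}^{k-1} 4^j c_{k,j} f⁽ᵏ⁻ʲ⁾_{n,m}`. -/
def hierarchySum (K : Type*) [Field K] (k : ℕ) : LatticeField K :=
  fun n m => ∑ j ∈ Finset.range k,
    C ((4 : K) ^ j * (symCoeff k j : K)) * volterraHierarchy K (k - j) n m

/-- The polynomial `(u_{n,m+1} + 1)(u_{n,m} - 1) - β (u_{n+1,m+1} - 1)(u_{n+1,m} + 1)`, whose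
vanishing for all `n, m` is the discrete equation. -/
def discreteEq {K : Type*} [Field K] (β : K) : LatticeField K :=
  fun n m => (X (n, m + 1) + 1) * (X (n, m) - 1) -
    C β * ((X (n + 1, m + 1) - 1) * (X (n + 1, m) + 1))

/-- `u : ℤ × ℤ → K` solves the discrete equation `Φ_{n,m} = 0` on the whole lattice. -/
def IsLatticeSolution {K : Type*} [Field K] (Φ : LatticeField K) (u : ℤ × ℤ → K) : Prop :=
  ∀ n m : ℤ, eval u (Φ n m) = 0

/-- `∂_t u_{n,m} = h_{n,m}(u_{n,m+μ}, …, u_{n,m-μ})` is a generalized symmetry of order `μ > 0`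
in the `m`-direction of the discrete equation
`Φ_{n,m}(u_{n,m}, u_{n+1,m}, u_{n,m+1}, u_{n+1,m+1}) = 0`. -/
structure IsGeneralizedSymmetryM {K : Type*} [Field K] (Φ h : LatticeField K) (μ : ℕ) :
    Prop where
  order_pos : 0 < μ
  /-- `h_{n,m}` involves only the variables `u_{n,m+j}` with `-μ ≤ j ≤ μ`. -/
  vars_subset : ∀ n m : ℤ, ∀ v ∈ (h n m).vars, v.1 = n ∧ |v.2 - m| ≤ (μ : ℤ)
  upper : ∃ n m : ℤ, pderiv (n, m + (μ : ℤ)) (h n m) ≠ 0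
  lower : ∃ n m : ℤ, pderiv (n, m - (μ : ℤ)) (h n m) ≠ 0
  /-- The linearized equation
  `∑_{i,j ∈ {0,1}} h_{n+i,m+j} ∂Φ_{n,m}/∂u_{n+i,m+j} = 0` holds on all solutions. -/
  compatible : ∀ u : ℤ × ℤ → K, IsLatticeSolution Φ u → ∀ n m : ℤ,
    ∑ i ∈ Finset.range 2, ∑ j ∈ Finset.range 2,
      eval u (h (n + i) (m + j)) * eval u (pderiv (n + (i : ℤ), m + (j : ℤ)) (Φ n m)) = 0

/-- `h_{n,m}` has no explicit dependence on `n` and `m`: one polynomial `S` in variables indexed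
by `j ∈ ℤ` gives every `h_{n,m}` by the substitution of `u_{n,m+j}` for the `j`-th variable. -/
def IsAutonomous {K : Type*} [Field K] (h : LatticeField K) : Prop :=
  ∃ S : MvPolynomial ℤ K, ∀ n m : ℤ, h n m = rename (fun j : ℤ => (n, m + j)) S

end

/-! For ε = ±1 the Miura substitution v_m = (u_{n,m+1} + ε)(u_{n,m} - ε) carries the modified
Volterra lattice to the Volterra lattice V, and the discrete equation says exactly that v with ε = 1
at n equals β times v with ε = -1 at n + 1. The scaling v ↦ βv multiplies the Volterra flow F_k
(`volterraFlow`) by β^{k+1}. Hence if a single field in u induces F_k under both substitutions,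
weighting it by β^{n(k+1)} makes it compatible with the equation (`compatible_hierarchySum`).

That field is S_{k+1} (`hierarchySum`). The master symmetry g corresponds to G + 4E, where G is the
Volterra master symmetry and E the Euler field, and [E, F_k] = (k+1)F_k. The recursion for c_{k,j}
amounts to S_{k+2} = [g, S_{k+1}] - 4(k+1)S_{k+1}, which removes the contribution of E
(`related_miura_volterraFlow`).

A shift in m changes g by a multiple of f⁽¹⁾, so autonomy follows from [f⁽¹⁾, S_k] = 0. As the two
substitutions are jointly injective on vector fields, this reduces to [V, F_k] = 0
(`volterraFlow_commute`). By induction, [V, F_{k+1}] is a shift-invariant symmetry of V with zero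
linearization at v = 1, and such a field is zero (`shiftInvariant_symmetry_eq_zero`). The order is
read off the linear part at u = 0 (`eval_zero_pderiv_hierarchySum`). -/

noncomputable section

/-! ### Derivations of polynomial rings and their linearization -/

section Derivations

variable {σ τ K : Type*} [Field K]

/-- Derivations `D` and `D'` are related by `φ` if `φ ∘ D = D' ∘ φ`. -/
def Related (φ : MvPolynomial σ K →ₐ[K] MvPolynomial τ K)
    (D : Derivation K (MvPolynomial σ K) (MvPolynomial σ K))
    (D' : Derivation K (MvPolynomial τ K) (MvPolynomial τ K)) : Prop :=
  ∀ p, φ (D p) = D' (φ p)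

namespace Related

variable {φ : MvPolynomial σ K →ₐ[K] MvPolynomial τ K}
  {D D₁ D₂ : Derivation K (MvPolynomial σ K) (MvPolynomial σ K)}
  {D' D₁' D₂' : Derivation K (MvPolynomial τ K) (MvPolynomial τ K)}

theorem of_X (h : ∀ i, φ (D (X i)) = D' (φ (X i))) : Related φ D D' := by
  intro p
  induction p using MvPolynomial.induction_on with
  | C a => simp
  | add p q hp hq => simp [hp, hq]
  | mul_X p i hp => simp [hp, h i]

theorem lie (h₁ : Related φ D₁ D₁') (h₂ : Related φ D₂ D₂') :
    Related φ ⁅D₁, D₂⁆ ⁅D₁', D₂'⁆ := by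
  intro p
  rw [Derivation.commutator_apply, Derivation.commutator_apply, map_sub, h₁, h₂, h₂, h₁]

theorem sub (h₁ : Related φ D₁ D₁') (h₂ : Related φ D₂ D₂') :
    Related φ (D₁ - D₂) (D₁' - D₂') := by
  intro p
  simp [h₁ p, h₂ p]

theorem smul (a : K) (h : Related φ D D') : Related φ (a • D) (a • D') := by
  intro p
  simp [h p]

end Related

theorem lie_derivation_jacobi (D₁ D₂ D₃ : Derivation K (MvPolynomial σ K) (MvPolynomial σ K)) :
    ⁅D₁, ⁅D₂, D₃⁆⁆ = ⁅⁅D₁, D₂⁆, D₃⁆ + ⁅D₂, ⁅D₁, D₃⁆⁆ := by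
  ext p
  simp only [Derivation.commutator_apply, Derivation.add_apply, map_sub]
  ring_nf

theorem lie_derivation_smul (D₁ D₂ : Derivation K (MvPolynomial σ K) (MvPolynomial σ K)) (a : K) :
    ⁅D₁, a • D₂⁆ = a • ⁅D₁, D₂⁆ := by
  refine derivation_ext fun i => ?_
  simp [Derivation.commutator_apply, smul_sub]

theorem lie_derivation_neg (D₁ D₂ : Derivation K (MvPolynomial σ K) (MvPolynomial σ K)) :
    ⁅D₁, -D₂⁆ = -⁅D₁, D₂⁆ := by
  ext p
  simp [Derivation.commutator_apply]
  ring

theorem neg_lie_derivation (D₁ D₂ : Derivation K (MvPolynomial σ K) (MvPolynomial σ K)) :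
    ⁅-D₁, D₂⁆ = -⁅D₁, D₂⁆ := by
  ext p
  simp [Derivation.commutator_apply]
  ring

theorem pderiv_comm (i j : σ) (p : MvPolynomial σ K) :
    pderiv i (pderiv j p) = pderiv j (pderiv i p) := by
  classical
  have h : ⁅(pderiv i : Derivation K (MvPolynomial σ K) (MvPolynomial σ K)),
      (pderiv j : Derivation K (MvPolynomial σ K) (MvPolynomial σ K))⁆ = 0 := by
    refine derivation_ext fun l => ?_
    rw [Derivation.commutator_apply, pderiv_X, pderiv_X, Pi.single_apply, Pi.single_apply]
    split_ifs <;> simp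
  rw [← sub_eq_zero, ← Derivation.commutator_apply, h, Derivation.zero_apply]

/-- The commutator of `pderiv i` with `D` has these coefficients because each `pderiv i (X j)` is
constant. At a common zero of the coefficients of `D` only the second term survives, which gives
linear parts of brackets. -/
theorem pderiv_derivation (D : Derivation K (MvPolynomial σ K) (MvPolynomial σ K)) (i : σ)
    (p : MvPolynomial σ K) :
    pderiv i (D p) = D (pderiv i p) + mkDerivation K (fun j => pderiv i (D (X j))) p := by
  have h : ⁅(pderiv i : Derivation K (MvPolynomial σ K) (MvPolynomial σ K)), D⁆ =
      mkDerivation K (fun j => pderiv i (D (X j))) := by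
    classical
    refine derivation_ext fun j => ?_
    rw [Derivation.commutator_apply, mkDerivation_X, pderiv_X, Pi.single_apply]
    split_ifs <;> simp
  rw [← h, Derivation.commutator_apply]
  ring

/-- A derivation whose coefficients vanish at a point vanishes there. -/
theorem eval_derivation_eq_zero (a : σ → K)
    (D : Derivation K (MvPolynomial σ K) (MvPolynomial σ K)) (p : MvPolynomial σ K)
    (h : ∀ i ∈ p.vars, eval a (D (X i)) = 0) : eval a (D p) = 0 := by
  have key : ∀ q ∈ supported K (p.vars : Set σ), eval a (D q) = 0 := by
    intro q hq
    rw [supported_eq_adjoin_X] at hq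
    induction hq using Algebra.adjoin_induction with
    | mem x hx =>
      obtain ⟨i, hi, rfl⟩ := hx
      exact h i hi
    | algebraMap r => simp
    | add x y _ _ hx hy => simp [hx, hy]
    | mul x y _ _ hx hy => simp [hx, hy]
  exact key p (mem_supported_vars p)

theorem eq_zero_of_pderiv_X_mul_eq_zero [CharZero K] (i : σ) (p : MvPolynomial σ K)
    (h : pderiv i (X i * p) = 0) : p = 0 := by
  ext m
  have h' := congrArg (coeff m) h
  rw [coeff_pderiv, mul_comm, mul_comm (X i) p, coeff_mul_X, coeff_zero] at h'
  rcases mul_eq_zero.mp h' with h' | h'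
  · exact absurd h' (by exact_mod_cast Nat.succ_ne_zero (m i))
  · simpa using h'

end Derivations

/-! ### Volterra flows: shifts, homogeneity, the constant solution -/

section Volterra

variable (K : Type*) [Field K]

/-- The Volterra lattice `v_m ↦ v_m (v_{m+1} - v_{m-1})`. -/
def volterra : Derivation K (MvPolynomial ℤ K) (MvPolynomial ℤ K) :=
  mkDerivation K fun m => X m * (X (m + 1) - X (m - 1))

/-- The master symmetry of the Volterra lattice. -/
def volterraMaster : Derivation K (MvPolynomial ℤ K) (MvPolynomial ℤ K) :=
  mkDerivation K fun m =>
    X m * (C ((m : K) + 2) * X (m + 1) + X m - C ((m : K) - 1) * X (m - 1))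

/-- The Euler derivation. -/
def euler : Derivation K (MvPolynomial ℤ K) (MvPolynomial ℤ K) :=
  mkDerivation K fun m => X m

/-- The Volterra flows: `volterraFlow K k` is the flow of order `k + 1`. -/
def volterraFlow : ℕ → Derivation K (MvPolynomial ℤ K) (MvPolynomial ℤ K)
  | 0 => volterra K
  | k + 1 => ⁅volterraMaster K, volterraFlow k⁆

/-- The shift `v_m ↦ v_{m+a}`. -/
def shift (a : ℤ) : MvPolynomial ℤ K →ₐ[K] MvPolynomial ℤ K := rename (· + a)

variable {K}

@[simp]
theorem shift_X (a m : ℤ) : shift K a (X m) = X (m + a) := rename_X _ _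

theorem volterra_X (m : ℤ) : volterra K (X m) = X m * (X (m + 1) - X (m - 1)) :=
  mkDerivation_X _ _ _

theorem volterraMaster_X (m : ℤ) : volterraMaster K (X m) =
    X m * (C ((m : K) + 2) * X (m + 1) + X m - C ((m : K) - 1) * X (m - 1)) :=
  mkDerivation_X _ _ _

@[simp]
theorem euler_X (m : ℤ) : euler K (X m) = X m := mkDerivation_X _ _ _

theorem pderiv_shift (a i : ℤ) (p : MvPolynomial ℤ K) :
    pderiv i (shift K a p) = shift K a (pderiv (i - a) p) := by
  have := pderiv_rename (R := K) (f := (· + a)) (add_left_injective a) (i - a) p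
  simpa [shift] using this

theorem related_shift_volterra (a : ℤ) : Related (shift K a) (volterra K) (volterra K) := by
  refine Related.of_X fun m => ?_
  simp [volterra_X, add_right_comm, sub_add_eq_add_sub]

theorem related_shift_volterraMaster (a : ℤ) :
    Related (shift K a) (volterraMaster K) (volterraMaster K - (a : K) • volterra K) := by
  refine Related.of_X fun m => ?_
  simp [volterra_X, volterraMaster_X, add_right_comm, sub_add_eq_add_sub, smul_eq_C_mul,
    algHom_C]
  ring

theorem lie_euler_volterra : ⁅euler K, volterra K⁆ = volterra K := by
  refine derivation_ext fun m => ?_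
  simp [Derivation.commutator_apply, volterra_X]
  ring

theorem lie_euler_volterraMaster : ⁅euler K, volterraMaster K⁆ = volterraMaster K := by
  refine derivation_ext fun m => ?_
  simp [Derivation.commutator_apply, volterraMaster_X]
  ring

theorem lie_euler_volterraFlow (k : ℕ) :
    ⁅euler K, volterraFlow K k⁆ = ((k : K) + 1) • volterraFlow K k := by
  induction k with
  | zero => simp [volterraFlow, lie_euler_volterra]
  | succ k ih =>
    rw [volterraFlow, lie_derivation_jacobi, lie_euler_volterraMaster, ih, lie_derivation_smul]
    push_cast
    module

theorem lie_volterra_volterraFlow_one : ⁅volterra K, volterraFlow K 1⁆ = 0 := by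
  refine derivation_ext fun m => ?_
  have c2 : (C 2 : MvPolynomial ℤ K) = 2 := map_ofNat C 2
  have e1 : m + 1 - 1 = m := by ring
  have e2 : m - 1 + 1 = m := by ring
  have e3 : m + 1 + 1 = m + 2 := by ring
  have e4 : m - 1 - 1 = m - 2 := by ring
  have e5 : m + 2 + 1 = m + 3 := by ring
  have e6 : m + 2 - 1 = m + 1 := by ring
  have e7 : m - 2 + 1 = m - 1 := by ring
  have e8 : m - 2 - 1 = m - 3 := by ring
  simp [volterraFlow, Derivation.commutator_apply, volterra_X, volterraMaster_X,
    e1, e2, e3, e4, e5, e6, e7, e8]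
  rw [c2]
  ring

theorem eval_one_volterraFlow (k : ℕ) (m : ℤ) :
    eval (fun _ => (1 : K)) (volterraFlow K k (X m)) = 0 := by
  induction k generalizing m with
  | zero => simp [volterraFlow, volterra_X]
  | succ k ih =>
    have hE : euler K (volterraFlow K k (X m)) = ((k : K) + 2) • volterraFlow K k (X m) := by
      have := congrArg (fun D => D (X m)) (lie_euler_volterraFlow (K := K) k)
      simp only [Derivation.commutator_apply, euler_X, Derivation.smul_apply] at this
      rw [sub_eq_iff_eq_add] at this
      rw [this]
      module
    -- At v = 1 the master symmetry takes the value (m+2) + 1 - (m-1) = 4, so there it acts as 4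
    -- times the Euler field, which only rescales the homogeneous flow.
    have h4 := eval_derivation_eq_zero (fun _ => (1 : K)) (volterraMaster K - (4 : K) • euler K)
      (volterraFlow K k (X m)) (fun i _ => by simp [volterraMaster_X]; ring)
    rw [Derivation.sub_apply, Derivation.smul_apply, hE, map_sub, smul_eval, smul_eval, ih m] at h4
    rw [volterraFlow, Derivation.commutator_apply, map_sub,
      eval_derivation_eq_zero _ (volterraFlow K k) _ (fun i _ => ih i)]
    simpa using h4

end Volterra

/-! ### Rigidity of Volterra symmetries and commuting flows -/

section Volterra

variable {K : Type*} [Field K]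

theorem mkDerivation_pderiv_volterra (i : ℤ) (p : MvPolynomial ℤ K) :
    mkDerivation K (fun j => pderiv i (volterra K (X j))) p =
      X (i - 1) * pderiv (i - 1) p + (X (i + 1) - X (i - 1)) * pderiv i p -
        X (i + 1) * pderiv (i + 1) p := by
  have h : mkDerivation K (fun j => pderiv i (volterra K (X j))) =
      (X (i - 1) : MvPolynomial ℤ K) • pderiv (i - 1) +
        (X (i + 1) - X (i - 1) : MvPolynomial ℤ K) • pderiv i -
        (X (i + 1) : MvPolynomial ℤ K) • pderiv (i + 1) := by
    refine derivation_ext fun j => ?_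
    simp only [mkDerivation_X, volterra_X, Derivation.sub_apply, Derivation.add_apply,
      Derivation.smul_apply, smul_eq_mul, Derivation.leibniz, map_sub, pderiv_X, Pi.single_apply]
    by_cases h1 : j = i - 1
    · subst h1
      simp [show i - 1 - 1 ≠ i by omega, show i - 1 ≠ i + 1 by omega]
    by_cases h2 : j = i
    · subst h2
      simp [show j ≠ j - 1 by omega]
    by_cases h3 : j = i + 1
    · subst h3
      simp [show i + 1 + 1 ≠ i by omega, show i + 1 ≠ i - 1 by omega]
    have h4 : j + 1 ≠ i := by omega
    have h5 : j - 1 ≠ i := by omega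
    simp [h1, h2, h3, h4, h5]
  rw [h]
  simp

/-- The `i`-th partial derivative of `D_V w`, where `V` is the Volterra lattice. -/
theorem pderiv_volterra (i : ℤ) (p : MvPolynomial ℤ K) :
    pderiv i (volterra K p) = volterra K (pderiv i p) +
      (X (i - 1) * pderiv (i - 1) p + (X (i + 1) - X (i - 1)) * pderiv i p -
        X (i + 1) * pderiv (i + 1) p) := by
  rw [pderiv_derivation, mkDerivation_pderiv_volterra]

/-- A shift-invariant derivation applied to the Volterra lattice. -/
theorem shiftInvariant_apply_volterra_X {W : Derivation K (MvPolynomial ℤ K) (MvPolynomial ℤ K)}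
    (hW : ∀ a, Related (shift K a) W W) :
    W (volterra K (X 0)) = W (X 0) * (X 1 - X (-1)) +
      X 0 * (shift K 1 (W (X 0)) - shift K (-1) (W (X 0))) := by
  rw [hW, hW, shift_X, shift_X, volterra_X]
  simp
  ring

theorem eval_one_shift (a : ℤ) (p : MvPolynomial ℤ K) :
    eval (fun _ => (1 : K)) (shift K a p) = eval (fun _ => (1 : K)) p := by
  rw [shift, eval_rename]
  rfl

theorem shift_shift (a b : ℤ) (p : MvPolynomial ℤ K) :
    shift K a (shift K b p) = shift K (b + a) p := by
  simp only [shift, rename_rename]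
  congr 2
  funext x
  simp [add_assoc]

theorem shift_zero (p : MvPolynomial ℤ K) : shift K 0 p = p := by
  simp only [shift, add_zero]
  exact rename_id_apply p

/-- A solution of `v_μ P = v_0 T P`, `T` the shift, that vanishes at the constant `1` is zero. -/
theorem eq_zero_of_X_mul_eq_X_mul_shift (μ : ℤ) (P : MvPolynomial ℤ K)
    (h : X μ * P = X 0 * shift K 1 P) (h1 : eval (fun _ => (1 : K)) P = 0) : P = 0 := by
  have iter : ∀ r : ℕ, (∏ j ∈ Finset.range r, X (μ + j)) * P =
      (∏ j ∈ Finset.range r, X (j : ℤ)) * shift K r P := by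
    intro r
    induction r with
    | zero => simp [shift_zero]
    | succ r ih =>
      have hr := congrArg (shift K r) h
      simp only [map_mul, shift_X, shift_shift, zero_add] at hr
      rw [Finset.prod_range_succ, Finset.prod_range_succ, mul_right_comm, ih]
      push_cast
      rw [add_comm (r : ℤ) 1, mul_assoc (∏ j ∈ Finset.range r, X (j : ℤ)) (X (r : ℤ)), ← hr]
      ring
  obtain ⟨R, hR⟩ : ∃ R : ℕ, ∀ j ∈ P.vars, j.natAbs ≤ R :=
    ⟨P.vars.sup Int.natAbs, fun j hj => Finset.le_sup (f := Int.natAbs) hj⟩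
  -- Setting all variables beyond R to 1 fixes P but sends its shift by 2R + 1 to P(1, 1, …) = 0.
  -- The hypothesis at 1 is needed: v_0 ⋯ v_{μ-1} solves the equation when μ > 0.
  let ψ : MvPolynomial ℤ K →ₐ[K] MvPolynomial ℤ K :=
    aeval fun j => if j ≤ R then X j else 1
  have hψX : ∀ j, ψ (X j) = if j ≤ (R : ℤ) then X j else 1 := fun j => aeval_X _ _
  have hψP : ψ P = P := by
    have : (ψ : MvPolynomial ℤ K →+* MvPolynomial ℤ K) P =
        (RingHom.id (MvPolynomial ℤ K)) P := by
      refine hom_congr_vars ?_ ?_ rfl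
      · ext a
        simp
      · intro j hj _
        have := hR j hj
        have hj' : j ≤ (R : ℤ) := by omega
        change ψ (X j) = X j
        rw [hψX, if_pos hj']
    exact this
  have hψT : ψ (shift K ((2 * R + 1 : ℕ) : ℤ) P) = 0 := by
    have : ((ψ.comp (shift K ((2 * R + 1 : ℕ) : ℤ)) : MvPolynomial ℤ K →ₐ[K] _) :
        MvPolynomial ℤ K →+* MvPolynomial ℤ K) P =
        (C.comp (eval (fun _ => (1 : K)))) P := by
      refine hom_congr_vars ?_ ?_ rfl
      · ext a
        simp
      · intro j hj _
        have := hR j hj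
        have hj' : ¬ j + ((2 * R + 1 : ℕ) : ℤ) ≤ (R : ℤ) := by omega
        change ψ (shift K _ (X j)) = C (eval _ (X j))
        rw [shift_X, hψX, if_neg hj']
        simp
    change ψ (shift K _ P) = C (eval _ P) at this
    rw [this, h1, C_0]
  have := congrArg ψ (iter (2 * R + 1))
  rw [map_mul, map_mul, hψT, hψP, mul_zero, map_prod] at this
  refine (mul_eq_zero.mp this).resolve_left (Finset.prod_ne_zero_iff.mpr fun j _ => ?_)
  rw [hψX]
  split_ifs
  · exact X_ne_zero _
  · exact one_ne_zero

/-- A shift-invariant symmetry of the Volterra lattice whose linearization at the constant `1`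
has no positive shifts is zero. -/
theorem shiftInvariant_symmetry_eq_zero [CharZero K]
    {W : Derivation K (MvPolynomial ℤ K) (MvPolynomial ℤ K)}
    (hW : ∀ a, Related (shift K a) W W) (hV : ⁅volterra K, W⁆ = 0)
    (h1 : ∀ i : ℤ, 0 < i → eval (fun _ => (1 : K)) (pderiv i (W (X 0))) = 0) : W = 0 := by
  set w := W (X 0) with hw
  have eqn : volterra K w = w * (X 1 - X (-1)) + X 0 * (shift K 1 w - shift K (-1) w) := by
    rw [hw, ← shiftInvariant_apply_volterra_X hW, ← sub_eq_zero, ← Derivation.commutator_apply, hV,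
      Derivation.zero_apply]
  have step : ∀ μ : ℤ, 0 < μ → (∀ j, μ < j → pderiv j w = 0) → pderiv μ w = 0 := by
    intro μ hμ hj
    refine eq_zero_of_X_mul_eq_X_mul_shift μ _ ?_ (h1 μ hμ)
    -- If v_μ is the highest variable of w, only the top terms survive: v_μ ∂_μ w = v_0 T(∂_μ w).
    have e := congrArg (pderiv (μ + 1)) eqn
    have n1 : (1 : ℤ) ≠ μ + 1 := by omega
    have n2 : (-1 : ℤ) ≠ μ + 1 := by omega
    have n3 : (0 : ℤ) ≠ μ + 1 := by omega
    simpa [pderiv_volterra, pderiv_shift, hj (μ + 1) (by omega), hj (μ + 1 + 1) (by omega),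
      pderiv_X_of_ne n1, pderiv_X_of_ne n2, pderiv_X_of_ne n3] using e
  have descend : ∀ μ : ℕ, (∀ j, (μ : ℤ) < j → pderiv j w = 0) → ∀ j, 0 < j → pderiv j w = 0 := by
    intro μ
    induction μ with
    | zero => exact fun h => h
    | succ μ ih =>
      intro h
      refine ih fun j hj => ?_
      rcases lt_or_eq_of_le (Int.add_one_le_of_lt hj) with hj' | hj'
      · exact h j (by push_cast; exact hj')
      · exact step j (by omega) fun i hi => h i (by push_cast; omega)
  have hpos : ∀ j, 0 < j → pderiv j w = 0 := by
    refine descend (w.vars.sup Int.natAbs) fun j hj => pderiv_eq_zero_of_notMem_vars fun hmem => ?_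
    have := Finset.le_sup (f := Int.natAbs) hmem
    omega
  -- For μ = 0 the factor v_1 of the symmetry condition contributes the extra term w.
  -- Differentiating once more, in v_1 and in v_0, forces ∂_0 w = 0 and then w = 0.
  have e0 : X 0 * pderiv 0 w = w + X 0 * shift K 1 (pderiv 0 w) := by
    have e := congrArg (pderiv 1) eqn
    have n2 : (-1 : ℤ) ≠ 1 := by omega
    have n3 : (0 : ℤ) ≠ 1 := by omega
    simpa [pderiv_volterra, pderiv_shift, hpos 1 (by omega), hpos 2 (by omega),
      pderiv_X_of_ne n2, pderiv_X_of_ne n3] using e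
  have e1 : pderiv 0 (pderiv 0 w) = 0 := by
    have e := congrArg (pderiv 1) e0
    have n3 : (0 : ℤ) ≠ 1 := by omega
    simp only [map_add, pderiv_mul, pderiv_X_of_ne n3, pderiv_shift, hpos 1 (by omega), zero_mul,
      zero_add, sub_self] at e
    rw [pderiv_comm 1 0, hpos 1 (by omega), map_zero] at e
    have := congrArg (shift K (-1)) ((mul_eq_zero.mp (by simpa using e)).resolve_left (X_ne_zero 0))
    simpa [shift_shift, shift_zero] using this
  have e2 : pderiv 0 (X 0 * shift K 1 (pderiv 0 w)) = 0 := by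
    have e := congrArg (pderiv 0) e0
    rw [map_add, pderiv_mul, pderiv_X_self, e1] at e
    linear_combination -e
  have e3 : pderiv 0 w = 0 := by
    have e := congrArg (shift K (-1)) (eq_zero_of_pderiv_X_mul_eq_zero 0 _ e2)
    simpa [shift_shift, shift_zero] using e
  have hw0 : w = 0 := by
    rw [e3] at e0
    simpa using e0.symm
  refine derivation_ext fun m => ?_
  have := hW m (X 0)
  rw [← hw, hw0] at this
  simpa using this.symm

/-- Both fields vanish at 1, so the linearization of their bracket is the commutator of their
linearizations. These have shift-invariant constant coefficients and therefore commute. -/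
theorem eval_one_pderiv_lie_volterra {F : Derivation K (MvPolynomial ℤ K) (MvPolynomial ℤ K)}
    (hF : ∀ a, Related (shift K a) F F) (h1 : eval (fun _ => (1 : K)) (F (X 0)) = 0) (i : ℤ) :
    eval (fun _ => (1 : K)) (pderiv i (⁅volterra K, F⁆ (X 0))) = 0 := by
  have h0 : eval (fun _ => (1 : K)) (volterra K (pderiv i (F (X 0)))) = 0 :=
    eval_derivation_eq_zero _ _ _ fun j _ => by simp [volterra_X]
  rw [Derivation.commutator_apply, shiftInvariant_apply_volterra_X hF]
  simp [pderiv_volterra, h0, h1, pderiv_shift, eval_one_shift]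

/-- The two claims feed each other: shifting changes the master symmetry by a multiple of V, so [V,
F_k] = 0 makes F_{k+1} shift-invariant, and this invariance enters the proof that [V, F_{k+1}] = 0.
-/
theorem volterraFlow_commute [CharZero K] (k : ℕ) :
    ⁅volterra K, volterraFlow K k⁆ = 0 ∧
      ∀ a, Related (shift K a) (volterraFlow K k) (volterraFlow K k) := by
  induction k with
  | zero => exact ⟨lie_self _, fun a => related_shift_volterra a⟩
  | succ k ih =>
    have inv : ∀ a, Related (shift K a) (volterraFlow K (k + 1)) (volterraFlow K (k + 1)) := by
      intro a p
      have := (related_shift_volterraMaster a).lie (ih.2 a) p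
      rw [volterraFlow, this]
      have e := congrArg (fun D => D (shift K a p)) ih.1
      simp only [Derivation.commutator_apply, Derivation.zero_apply, sub_eq_zero] at e
      simp only [Derivation.commutator_apply, Derivation.sub_apply, Derivation.smul_apply,
        map_sub, Derivation.map_smul, e]
      abel
    refine ⟨shiftInvariant_symmetry_eq_zero (fun a => (related_shift_volterra a).lie (inv a)) ?_
      fun i _ => eval_one_pderiv_lie_volterra inv (eval_one_volterraFlow _ _) i, inv⟩
    -- By Jacobi, [V, F_{k+1}] = -[F_1, F_k], and V commutes with both F_1 and F_k.
    have anti : ⁅volterra K, volterraMaster K⁆ = -volterraFlow K 1 := by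
      ext p
      simp [volterraFlow, Derivation.commutator_apply]
    rw [volterraFlow, lie_derivation_jacobi _ (volterraMaster K), ih.1, anti, neg_lie_derivation]
    rw [show ⁅volterraMaster K, (0 : Derivation K (MvPolynomial ℤ K) (MvPolynomial ℤ K))⁆ = 0 by
      ext; simp [Derivation.commutator_apply], add_zero, lie_derivation_neg,
      lie_derivation_jacobi _ (volterraFlow K 1), ih.1,
      lie_volterra_volterraFlow_one]
    simp

end Volterra

/-! ### Recursion for the hierarchy sums -/

section Lattice

variable {K : Type*} [Field K]

theorem totalDeriv_X (h : LatticeField K) (v : ℤ × ℤ) : totalDeriv h (X v) = h v.1 v.2 :=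
  mkDerivation_X _ _ _

theorem totalDeriv_lieBracket (g f : LatticeField K) :
    totalDeriv (lieBracket g f) = ⁅totalDeriv g, totalDeriv f⁆ := by
  refine derivation_ext fun v => ?_
  simp [Derivation.commutator_apply, totalDeriv_X, lieBracket]

theorem lieBracket_eq (g f : LatticeField K) (n m : ℤ) :
    lieBracket g f n m = ⁅totalDeriv g, totalDeriv f⁆ (X (n, m)) := by
  rw [← totalDeriv_lieBracket, totalDeriv_X]

theorem derivation_sum_apply {σ ι : Type*} (s : Finset ι)
    (D : ι → Derivation K (MvPolynomial σ K) (MvPolynomial σ K)) (p : MvPolynomial σ K) :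
    (∑ j ∈ s, D j) p = ∑ j ∈ s, D j p := by
  classical
  induction s using Finset.induction_on with
  | empty => simp
  | insert a s ha ih => rw [Finset.sum_insert ha, Finset.sum_insert ha, Derivation.add_apply, ih]

theorem hierarchySum_one : hierarchySum K 1 = modifiedVolterra K := by
  funext n m
  simp [hierarchySum, symCoeff, volterraHierarchy]

theorem totalDeriv_hierarchySum (k : ℕ) : totalDeriv (hierarchySum K k) =
    ∑ j ∈ Finset.range k, ((4 : K) ^ j * (symCoeff k j : K)) •
      totalDeriv (volterraHierarchy K (k - j)) := by
  refine derivation_ext fun v => ?_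
  rw [totalDeriv_X, hierarchySum, derivation_sum_apply]
  exact Finset.sum_congr rfl fun j _ => by
    rw [Derivation.smul_apply, totalDeriv_X, smul_eq_C_mul]

theorem hierarchySum_succ (k : ℕ) (n m : ℤ) : hierarchySum K (k + 2) n m =
    lieBracket (masterSymmetry K) (hierarchySum K (k + 1)) n m -
      C (4 * ((k : K) + 1)) * hierarchySum K (k + 1) n m := by
  have hb : lieBracket (masterSymmetry K) (hierarchySum K (k + 1)) n m =
      ∑ j ∈ Finset.range (k + 1), C ((4 : K) ^ j * (symCoeff (k + 1) j : K)) *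
        volterraHierarchy K (k + 2 - j) n m := by
    rw [lieBracket, totalDeriv_hierarchySum, hierarchySum, map_sum, derivation_sum_apply,
      ← Finset.sum_sub_distrib]
    refine Finset.sum_congr rfl fun j hj => ?_
    obtain ⟨i, hi⟩ : ∃ i, k = j + i := ⟨k - j, by have := Finset.mem_range.mp hj; omega⟩
    have h1 : k + 1 - j = i + 1 := by omega
    have h2 : k + 2 - j = i + 2 := by omega
    rw [h1, h2, volterraHierarchy, lieBracket, ← smul_eq_C_mul, ← smul_eq_C_mul,
      Derivation.map_smul, Derivation.smul_apply, smul_sub]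
  have hz : lieBracket (masterSymmetry K) (hierarchySum K (k + 1)) n m =
      ∑ j ∈ Finset.range (k + 2), C ((4 : K) ^ j * (symCoeff (k + 1) j : K)) *
        volterraHierarchy K (k + 2 - j) n m := by
    rw [hb, Finset.sum_range_succ _ (k + 1), symCoeff_eq_zero_of_le (k + 1) (k + 1) le_rfl]
    simp
  rw [hz, hierarchySum, hierarchySum, Finset.sum_range_succ', Finset.sum_range_succ' _ (k + 1),
    Finset.mul_sum, add_sub_right_comm, ← Finset.sum_sub_distrib]
  congr 1
  refine Finset.sum_congr rfl fun j _ => ?_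
  rw [show k + 2 - (j + 1) = k + 1 - j by omega, symCoeff, ← mul_assoc, ← C_mul, ← sub_mul, ← C_sub]
  congr 2
  push_cast
  ring

theorem totalDeriv_hierarchySum_succ (k : ℕ) : totalDeriv (hierarchySum K (k + 2)) =
    ⁅totalDeriv (masterSymmetry K), totalDeriv (hierarchySum K (k + 1))⁆ -
      (4 * ((k : K) + 1)) • totalDeriv (hierarchySum K (k + 1)) := by
  refine derivation_ext fun v => ?_
  rw [totalDeriv_X, hierarchySum_succ, lieBracket_eq, Derivation.sub_apply, Derivation.smul_apply,
    totalDeriv_X, smul_eq_C_mul]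

/-! ### Miura correspondence with the Volterra flows -/

/-- The Miura substitution `v_m = (u_{n,m+1} + ε)(u_{n,m} - ε)`. -/
def miura (ε : K) (n : ℤ) : MvPolynomial ℤ K →ₐ[K] LatticePoly K :=
  aeval fun m => (X (n, m + 1) + C ε) * (X (n, m) - C ε)

theorem miura_X (ε : K) (n m : ℤ) :
    miura ε n (X m) = (X (n, m + 1) + C ε) * (X (n, m) - C ε) := aeval_X _ _

theorem related_miura_volterra {ε : K} (hε : ε = 1 ∨ ε = -1) (n : ℤ) :
    Related (miura ε n) (volterra K) (totalDeriv (modifiedVolterra K)) := by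
  refine Related.of_X fun m => ?_
  have hε2 : (C ε : LatticePoly K) ^ 2 = 1 := by
    rcases hε with rfl | rfl <;> simp
  simp only [volterra_X, map_mul, map_sub, miura_X, Derivation.leibniz, map_add, derivation_C,
    totalDeriv_X, modifiedVolterra, ← hε2, add_sub_cancel_right, sub_add_cancel, smul_eq_mul]
  ring

theorem related_miura_volterraMaster {ε : K} (hε : ε = 1 ∨ ε = -1) (n : ℤ) :
    Related (miura ε n) (volterraMaster K + (4 : K) • euler K)
      (totalDeriv (masterSymmetry K)) := by
  refine Related.of_X fun m => ?_
  have hε2 : (C ε : LatticePoly K) ^ 2 = 1 := by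
    rcases hε with rfl | rfl <;> simp
  simp only [volterraMaster_X, map_mul, map_sub, miura_X, Derivation.leibniz, map_add, derivation_C,
    totalDeriv_X, masterSymmetry, add_sub_cancel_right, sub_add_cancel, smul_eq_mul,
    Derivation.add_apply, Derivation.smul_apply, euler_X, smul_eq_C_mul, algHom_C,
    algebraMap_eq, Int.cast_add, Int.cast_one, map_one, map_ofNat]
  rcases hε with rfl | rfl
  · simp only [map_one]
    ring
  · simp only [map_one, map_neg]
    ring

theorem related_miura_volterraFlow {ε : K} (hε : ε = 1 ∨ ε = -1) (n : ℤ) (k : ℕ) :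
    Related (miura ε n) (volterraFlow K k) (totalDeriv (hierarchySum K (k + 1))) := by
  induction k with
  | zero =>
    rw [zero_add, hierarchySum_one]
    exact related_miura_volterra hε n
  | succ k ih =>
    have h := ((related_miura_volterraMaster hε n).lie ih).sub (ih.smul (4 * ((k : K) + 1)))
    rw [← totalDeriv_hierarchySum_succ] at h
    convert h using 1
    refine derivation_ext fun m => ?_
    have e := congrArg (fun D => D (X m)) (lie_euler_volterraFlow (K := K) k)
    simp only [volterraFlow, Derivation.commutator_apply, Derivation.add_apply,
      Derivation.sub_apply, Derivation.smul_apply, map_add, Derivation.map_smul] at e ⊢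
    rw [sub_eq_iff_eq_add] at e
    rw [e]
    module

/-- The two Miura substitutions are jointly injective on vector fields. -/
theorem eq_zero_of_related_miura [CharZero K] {D : Derivation K (LatticePoly K) (LatticePoly K)}
    (h1 : ∀ n, Related (miura 1 n) 0 D) (h2 : ∀ n, Related (miura (-1) n) 0 D) : D = 0 := by
  refine derivation_ext fun ⟨n, m⟩ => ?_
  have e1 := h1 n (X m)
  have e2 := h2 n (X m)
  simp only [Derivation.zero_apply, map_zero, miura_X, Derivation.leibniz, map_add, map_sub,
    derivation_C, smul_eq_mul] at e1 e2
  simp only [map_one, map_neg] at e1 e2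
  have two : (2 : LatticePoly K) ≠ 0 := two_ne_zero
  -- The two products differ by 2(u_{n,m} - u_{n,m+1}) and sum to 2(u_{n,m}u_{n,m+1} - 1); `D` kills
  -- both.
  have hd : D (X (n, m + 1)) = D (X (n, m)) := by
    refine mul_left_cancel₀ two ?_
    linear_combination e1 - e2
  rw [hd] at e1 e2
  have hp : 2 * (X (n, m) + X (n, m + 1)) * D (X (n, m)) = 0 := by
    linear_combination -e1 - e2
  refine (mul_eq_zero.mp hp).resolve_left (mul_ne_zero two fun h => ?_)
  have := congrArg (eval (fun v => if v = (n, m) then (1 : K) else 0)) h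
  simp at this

theorem lie_modifiedVolterra_hierarchySum [CharZero K] (k : ℕ) :
    ⁅totalDeriv (modifiedVolterra K), totalDeriv (hierarchySum K (k + 1))⁆ = 0 := by
  refine eq_zero_of_related_miura (fun n => ?_) fun n => ?_
  · have := (related_miura_volterra (Or.inl rfl) n).lie
      (related_miura_volterraFlow (K := K) (Or.inl rfl) n k)
    rwa [(volterraFlow_commute k).1] at this
  · have := (related_miura_volterra (Or.inr rfl) n).lie
      (related_miura_volterraFlow (K := K) (Or.inr rfl) n k)
    rwa [(volterraFlow_commute k).1] at this

/-! ### Shift invariance of the hierarchy sums -/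

/-- The substitution `u_{n,m} ↦ u_{n+a,m+b}`. -/
def latticeShift (K : Type*) [Field K] (a b : ℤ) : LatticePoly K →ₐ[K] LatticePoly K :=
  rename fun v => (v.1 + a, v.2 + b)

theorem latticeShift_X (a b n m : ℤ) :
    latticeShift K a b (X (n, m)) = X (n + a, m + b) := rename_X _ _

theorem related_latticeShift_modifiedVolterra (a b : ℤ) : Related (latticeShift K a b)
    (totalDeriv (modifiedVolterra K)) (totalDeriv (modifiedVolterra K)) := by
  refine Related.of_X fun ⟨n, m⟩ => ?_
  simp [latticeShift_X, totalDeriv_X, modifiedVolterra, add_right_comm, sub_add_eq_add_sub]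

theorem related_latticeShift_masterSymmetry (a b : ℤ) : Related (latticeShift K a b)
    (totalDeriv (masterSymmetry K))
    (totalDeriv (masterSymmetry K) - (b : K) • totalDeriv (modifiedVolterra K)) := by
  refine Related.of_X fun ⟨n, m⟩ => ?_
  simp [latticeShift_X, totalDeriv_X, modifiedVolterra, masterSymmetry, add_right_comm,
    sub_add_eq_add_sub, smul_eq_C_mul]
  ring

theorem related_latticeShift_hierarchySum [CharZero K] (k : ℕ) (a b : ℤ) :
    Related (latticeShift K a b) (totalDeriv (hierarchySum K (k + 1)))
      (totalDeriv (hierarchySum K (k + 1))) := by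
  induction k with
  | zero =>
    rw [zero_add, hierarchySum_one]
    exact related_latticeShift_modifiedVolterra a b
  | succ k ih =>
    have h := ((related_latticeShift_masterSymmetry a b).lie ih).sub
      (ih.smul (4 * ((k : K) + 1)))
    rw [← totalDeriv_hierarchySum_succ] at h
    convert h using 1
    rw [totalDeriv_hierarchySum_succ]
    congr 1
    ext1 v
    have e := congrArg (fun D => D (X v)) (lie_modifiedVolterra_hierarchySum (K := K) k)
    simp only [Derivation.commutator_apply, Derivation.zero_apply, sub_eq_zero] at e
    simp only [Derivation.commutator_apply, Derivation.sub_apply, Derivation.smul_apply,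
      map_sub, Derivation.map_smul, e]
    abel

theorem latticeShift_hierarchySum [CharZero K] (k : ℕ) (n m : ℤ) :
    latticeShift K n m (hierarchySum K (k + 1) 0 0) = hierarchySum K (k + 1) n m := by
  have := related_latticeShift_hierarchySum (K := K) k n m (X (0, 0))
  simpa [totalDeriv_X, latticeShift_X] using this

/-! ### Support and exact order -/

theorem derivation_mem_supported {σ : Type*} {s t : Set σ} (hst : s ⊆ t)
    {D : Derivation K (MvPolynomial σ K) (MvPolynomial σ K)}
    (hD : ∀ i ∈ s, D (X i) ∈ supported K t) {p : MvPolynomial σ K} (hp : p ∈ supported K s) :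
    D p ∈ supported K t := by
  have hs : ∀ q ∈ supported K s, q ∈ supported K t := fun q hq => supported_mono hst hq
  rw [supported_eq_adjoin_X] at hp
  induction hp using Algebra.adjoin_induction with
  | mem x hx =>
    obtain ⟨i, hi, rfl⟩ := hx
    exact hD i hi
  | algebraMap r => simp
  | add x y _ _ hx hy =>
    rw [map_add]
    exact add_mem hx hy
  | mul x y hx' hy' hx hy =>
    rw [← supported_eq_adjoin_X] at hx' hy'
    rw [Derivation.leibniz]
    exact add_mem (mul_mem (hs _ hx') hy) (mul_mem (hs _ hy') hx)

/-- The lattice points `(n, j)` with `|j - m| ≤ r`. -/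
def rowInterval (n m : ℤ) (r : ℕ) : Set (ℤ × ℤ) := {v | v.1 = n ∧ |v.2 - m| ≤ (r : ℤ)}

theorem rowInterval_subset {n m : ℤ} {r s t : ℕ} {v : ℤ × ℤ} (hv : v ∈ rowInterval n m r)
    (h : r + s ≤ t) : rowInterval v.1 v.2 s ⊆ rowInterval n m t := by
  rintro w ⟨h1, h2⟩
  obtain ⟨h3, h4⟩ := hv
  refine ⟨h1.trans h3, ?_⟩
  rw [abs_le] at *
  omega

theorem X_mem_supported_rowInterval (n m j : ℤ) (r : ℕ) (h : |j - m| ≤ (r : ℤ)) :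
    (X (n, j) : LatticePoly K) ∈ supported K (rowInterval n m r) :=
  X_mem_supported.mpr ⟨rfl, h⟩

theorem masterSymmetry_mem_supported (n m : ℤ) :
    masterSymmetry K n m ∈ supported K (rowInterval n m 1) := by
  have h0 := X_mem_supported_rowInterval (K := K) n m m 1 (by simp)
  have h1 := X_mem_supported_rowInterval (K := K) n m (m + 1) 1 (by simp)
  have h2 := X_mem_supported_rowInterval (K := K) n m (m - 1) 1 (by simp)
  exact mul_mem (sub_mem (pow_mem h0 2) (one_mem _))
    (sub_mem (mul_mem (Subalgebra.algebraMap_mem _ _) h1)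
      (mul_mem (Subalgebra.algebraMap_mem _ _) h2))

theorem hierarchySum_mem_supported (k : ℕ) (n m : ℤ) :
    hierarchySum K (k + 1) n m ∈ supported K (rowInterval n m (k + 1)) := by
  induction k generalizing n m with
  | zero =>
    rw [zero_add, hierarchySum_one]
    have h0 := X_mem_supported_rowInterval (K := K) n m m 1 (by simp)
    have h1 := X_mem_supported_rowInterval (K := K) n m (m + 1) 1 (by simp)
    have h2 := X_mem_supported_rowInterval (K := K) n m (m - 1) 1 (by simp)
    exact mul_mem (sub_mem (pow_mem h0 2) (one_mem _)) (sub_mem h1 h2)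
  | succ k ih =>
    have hmono : ∀ r ≤ k + 1 + 1, rowInterval n m r ⊆ rowInterval n m (k + 1 + 1) :=
      fun r hr => rowInterval_subset (v := (n, m)) (r := 0) ⟨rfl, by simp⟩ (by omega)
    rw [hierarchySum_succ, lieBracket]
    refine sub_mem (sub_mem ?_ ?_) (mul_mem (Subalgebra.algebraMap_mem _ _)
      (supported_mono (hmono _ (by omega)) (ih n m)))
    · refine derivation_mem_supported (hmono _ (by omega)) (fun v hv => ?_) (ih n m)
      rw [totalDeriv_X]
      exact supported_mono (rowInterval_subset hv (by omega)) (masterSymmetry_mem_supported _ _)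
    · refine derivation_mem_supported (hmono 1 (by omega)) (fun v hv => ?_)
        (masterSymmetry_mem_supported n m)
      rw [totalDeriv_X]
      exact supported_mono (rowInterval_subset hv (by omega)) (ih _ _)

theorem pderiv_hierarchySum_eq_zero (k : ℕ) (n m : ℤ) (v : ℤ × ℤ)
    (hv : v ∉ rowInterval n m (k + 1)) : pderiv v (hierarchySum K (k + 1) n m) = 0 :=
  pderiv_eq_zero_of_notMem_vars fun h => hv (mem_supported.mp (hierarchySum_mem_supported k n m) h)

theorem eval_zero_masterSymmetry (n m : ℤ) :
    eval (fun _ => (0 : K)) (masterSymmetry K n m) = 0 := by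
  simp [masterSymmetry]

theorem eval_zero_hierarchySum (k : ℕ) (n m : ℤ) :
    eval (fun _ => (0 : K)) (hierarchySum K (k + 1) n m) = 0 := by
  induction k generalizing n m with
  | zero => simp [hierarchySum_one, modifiedVolterra]
  | succ k ih =>
    rw [hierarchySum_succ, lieBracket, map_sub, map_sub, map_mul, ih,
      eval_derivation_eq_zero _ _ _ fun v _ => by rw [totalDeriv_X, eval_zero_masterSymmetry],
      eval_derivation_eq_zero _ _ _ fun v _ => by rw [totalDeriv_X, ih]]
    simp

theorem eval_zero_pderiv_masterSymmetry (n m j : ℤ) :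
    eval (fun _ => (0 : K)) (pderiv (n, j) (masterSymmetry K n m)) =
      (if j = m - 1 then (m : K) - 1 else 0) - if j = m + 1 then (m : K) + 1 else 0 := by
  simp only [masterSymmetry, pderiv_mul, map_sub, pderiv_pow, pderiv_X, Pi.single_apply,
    pderiv_C, Prod.mk.injEq, true_and, map_add, map_mul, eval_X, eval_C, map_one, map_pow,
    Derivation.map_one_eq_zero, eq_comm (a := m + 1), eq_comm (a := m - 1)]
  split_ifs <;> first | omega | simp

/-- The linear part at `0` of the coefficients of extreme order of `hierarchySum K (k + 1)`. -/
theorem eval_zero_pderiv_hierarchySum [CharZero K] {s : ℤ} (hs : s = 1 ∨ s = -1) (k : ℕ) :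
    ∃ a : K, a ≠ 0 ∧ ∀ n m : ℤ, eval (fun _ => (0 : K))
      (pderiv (n, m + s * (k + 1 : ℕ)) (hierarchySum K (k + 1) n m)) = a := by
  induction k with
  | zero =>
    refine ⟨-s, ?_, fun n m => ?_⟩
    · rcases hs with rfl | rfl <;> simp
    · rw [zero_add, hierarchySum_one]
      simp only [modifiedVolterra, pderiv_mul, map_sub, pderiv_pow, pderiv_X, Pi.single_apply,
        Prod.mk.injEq, true_and, map_add, map_mul, eval_X, map_one, map_pow,
        Derivation.map_one_eq_zero]
      rcases hs with rfl | rfl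
      · simp [show m - 1 ≠ m + 1 by omega]
      · simp [show m + 1 ≠ m + -1 by omega, sub_eq_add_neg]
  | succ k ih =>
    obtain ⟨a, ha, h⟩ := ih
    refine ⟨-((k : K) + 1) * a, mul_ne_zero (neg_ne_zero.mpr (Nat.cast_add_one_ne_zero k)) ha,
      fun n m => ?_⟩
    set i : ℤ × ℤ := (n, m + s * (k + 1 + 1 : ℕ)) with hi
    -- The linear part of g at index j is -(j+1)u_{j+1} + (j-1)u_{j-1}. The extreme variable is
    -- reached only through j = m + s(k+1) here, and only through j = m + s in `hS`. The terms in m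
    -- cancel in the difference, leaving -(k+1)a.
    have hg : eval (fun _ => (0 : K)) (mkDerivation K (fun v => pderiv i
        (totalDeriv (masterSymmetry K) (X v))) (hierarchySum K (k + 1) n m)) =
        -((s : K) * m + k + 2) * a := by
      have := eval_derivation_eq_zero (fun _ => (0 : K)) (mkDerivation K (fun v => pderiv i
        (totalDeriv (masterSymmetry K) (X v))) - (-((s : K) * m + k + 2)) •
          pderiv (n, m + s * (k + 1 : ℕ))) (hierarchySum K (k + 1) n m) fun v hv => by
        obtain ⟨n', j⟩ := v
        obtain ⟨h1, h2⟩ := mem_supported.mp (hierarchySum_mem_supported k n m) hv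
        dsimp only at h1 h2
        subst h1
        rw [abs_le] at h2
        rw [Derivation.sub_apply, mkDerivation_X, totalDeriv_X, map_sub, hi,
          eval_zero_pderiv_masterSymmetry, Derivation.smul_apply, smul_eval, pderiv_X,
          Pi.single_apply]
        rcases hs with rfl | rfl
        · by_cases hj : j = m + 1 * (k + 1 : ℕ)
          · subst hj
            rw [if_neg (by omega), if_pos (by push_cast; ring), if_pos rfl]
            simp
            ring
          · rw [if_neg (by omega), if_neg (by omega), if_neg (by simp; omega)]
            simp
        · by_cases hj : j = m + -1 * (k + 1 : ℕ)
          · subst hj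
            rw [if_pos (by push_cast; ring), if_neg (by omega), if_pos rfl]
            simp
            ring
          · rw [if_neg (by omega), if_neg (by omega), if_neg (by simp; omega)]
            simp
      rw [Derivation.sub_apply, Derivation.smul_apply, map_sub, smul_eval, h, sub_eq_zero] at this
      exact this
    have hS : eval (fun _ => (0 : K)) (mkDerivation K (fun v => pderiv i
        (totalDeriv (hierarchySum K (k + 1)) (X v))) (masterSymmetry K n m)) =
        -((s : K) * m + 1) * a := by
      have := eval_derivation_eq_zero (fun _ => (0 : K)) (mkDerivation K (fun v => pderiv i
        (totalDeriv (hierarchySum K (k + 1)) (X v))) - a • pderiv (n, m + s))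
        (masterSymmetry K n m) fun v hv => by
        obtain ⟨n', j⟩ := v
        obtain ⟨h1, h2⟩ := mem_supported.mp (masterSymmetry_mem_supported n m) hv
        dsimp only at h1 h2
        subst h1
        rw [abs_le] at h2
        rw [Derivation.sub_apply, mkDerivation_X, totalDeriv_X, map_sub, hi,
          Derivation.smul_apply, smul_eval, pderiv_X, Pi.single_apply]
        by_cases hj : j = m + s
        · subst hj
          have := h n' (m + s)
          rw [show m + s + s * (k + 1 : ℕ) = m + s * (k + 1 + 1 : ℕ) by push_cast; ring] at this
          rw [this, if_pos rfl]
          simp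
        · rw [pderiv_hierarchySum_eq_zero, if_neg (by simpa using hj)]
          · simp
          · rintro ⟨-, h3⟩
            dsimp only at h3
            rw [abs_le] at h3
            rcases hs with rfl | rfl <;> omega
      rw [Derivation.sub_apply, Derivation.smul_apply, map_sub, smul_eval, sub_eq_zero,
        eval_zero_pderiv_masterSymmetry] at this
      rw [this]
      rcases hs with rfl | rfl
      · rw [if_neg (by omega), if_pos rfl]
        push_cast
        ring
      · rw [if_pos (by ring), if_neg (by omega)]
        push_cast
        ring
    have hz : pderiv i (hierarchySum K (k + 1) n m) = 0 := by
      refine pderiv_hierarchySum_eq_zero k n m i ?_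
      rintro ⟨-, h3⟩
      simp only [hi] at h3
      rw [abs_le] at h3
      rcases hs with rfl | rfl <;> omega
    rw [hierarchySum_succ, lieBracket, map_sub, pderiv_C_mul, hz, mul_zero, sub_zero, map_sub,
      pderiv_derivation, pderiv_derivation, hz, map_zero, zero_add, map_sub, map_add, hg, hS,
      eval_derivation_eq_zero _ _ _ fun v _ => by rw [totalDeriv_X, eval_zero_hierarchySum]]
    ring

end Lattice

/-! ### Scaling, compatibility with the discrete equation, autonomy -/

section Symmetry

variable {K : Type*} [Field K]

/-- The scaling `v_m ↦ β v_m`. -/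
def scale (β : K) : MvPolynomial ℤ K →ₐ[K] MvPolynomial ℤ K := aeval fun m => C β * X m

theorem scale_X (β : K) (m : ℤ) : scale β (X m) = C β * X m := aeval_X _ _

theorem related_scale_volterraFlow (β : K) (k : ℕ) :
    Related (scale β) (volterraFlow K k) (β ^ (k + 1) • volterraFlow K k) := by
  induction k with
  | zero =>
    refine Related.of_X fun m => ?_
    simp [volterraFlow, volterra_X, scale_X, smul_eq_C_mul]
    ring
  | succ k ih =>
    have hG : Related (scale β) (volterraMaster K) (β • volterraMaster K) := by
      refine Related.of_X fun m => ?_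
      simp [volterraMaster_X, scale_X, smul_eq_C_mul, algHom_C]
      ring
    have key : β ^ (k + 1 + 1) • volterraFlow K (k + 1) =
        ⁅β • volterraMaster K, β ^ (k + 1) • volterraFlow K k⁆ := by
      refine derivation_ext fun m => ?_
      rw [volterraFlow, Derivation.smul_apply, Derivation.commutator_apply,
        Derivation.commutator_apply, Derivation.smul_apply, Derivation.smul_apply,
        Derivation.smul_apply, Derivation.smul_apply, Derivation.map_smul, Derivation.map_smul]
      module
    rw [key]
    exact hG.lie ih

theorem eval_scaled_volterraFlow (β : K) (k : ℕ) (m : ℤ) (a : ℤ → K) :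
    eval (fun j => β * a j) (volterraFlow K k (X m)) =
      β ^ (k + 2) * eval a (volterraFlow K k (X m)) := by
  have h := congrArg (eval a) (related_scale_volterraFlow β k (X m))
  have he : ∀ p, eval a (scale β p) = eval (fun j => β * a j) p := by
    intro p
    induction p using MvPolynomial.induction_on with
    | C a => simp
    | add p q hp hq => simp [hp, hq]
    | mul_X p i hp => simp [hp, scale_X]
  rw [he, scale_X, Derivation.smul_apply, ← smul_eq_C_mul, Derivation.map_smul, smul_eval,
    smul_eval] at h
  rw [h]
  ring

theorem eval_miura (u : ℤ × ℤ → K) (ε : K) (n : ℤ) (p : MvPolynomial ℤ K) :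
    eval u (miura ε n p) = eval (fun m => (u (n, m + 1) + ε) * (u (n, m) - ε)) p := by
  induction p using MvPolynomial.induction_on with
  | C a => simp
  | add p q hp hq => simp [hp, hq]
  | mul_X p i hp => simp [hp, miura_X]

theorem compatible_hierarchySum (β : K) (hβ : β ≠ 0) (k : ℕ) (u : ℤ × ℤ → K)
    (hu : IsLatticeSolution (discreteEq β) u) (n m : ℤ) :
    ∑ i ∈ Finset.range 2, ∑ j ∈ Finset.range 2,
      eval u (C (β ^ ((n + i) * ((k + 1 : ℕ) : ℤ))) * hierarchySum K (k + 1) (n + i) (m + j)) *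
        eval u (pderiv (n + (i : ℤ), m + (j : ℤ)) (discreteEq β n m)) = 0 := by
  have hsol : (fun j => (u (n, j + 1) + 1) * (u (n, j) - 1)) =
      fun j => β * ((u (n + 1, j + 1) + -1) * (u (n + 1, j) - -1)) := by
    funext j
    have := hu n j
    simp [discreteEq] at this
    linear_combination this
  have h1 := congrArg (eval u) (related_miura_volterraFlow (K := K) (Or.inl rfl) n k (X m))
  have h2 := congrArg (eval u) (related_miura_volterraFlow (K := K) (Or.inr rfl) (n + 1) k (X m))
  rw [eval_miura, miura_X] at h1 h2
  -- The components of F_k have degree k + 2. Of the factor β^{k+2}, one β is the coefficient in the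
  -- discrete equation and β^{k+1} is the ratio of the multipliers at n + 1 and n.
  rw [hsol, eval_scaled_volterraFlow, h2] at h1
  have hpow : β ^ ((n + 1) * ((k + 1 : ℕ) : ℤ)) = β ^ (n * ((k + 1 : ℕ) : ℤ)) * β ^ (k + 1) := by
    rw [add_mul, zpow_add₀ hβ, one_mul, zpow_natCast]
  simp only [Derivation.leibniz, map_add, map_sub, derivation_C, totalDeriv_X, smul_eq_mul,
    map_mul, eval_X, eval_C, add_zero, sub_zero] at h1
  simp [Finset.sum_range_succ, discreteEq, pderiv_X, Pi.single_apply]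
  rw [show ((k : ℤ) + 1) = ((k + 1 : ℕ) : ℤ) by push_cast; rfl, hpow]
  linear_combination -β ^ (n * ((k + 1 : ℕ) : ℤ)) * h1

theorem isAutonomous_hierarchySum [CharZero K] (k : ℕ) :
    IsAutonomous (hierarchySum K (k + 1)) := by
  -- All variables at the origin have first index 0, so forgetting that index loses nothing.
  refine ⟨rename Prod.snd (hierarchySum K (k + 1) 0 0), fun n m => ?_⟩
  rw [rename_rename, ← latticeShift_hierarchySum]
  refine hom_congr_vars (f₁ := (latticeShift K n m : LatticePoly K →+* LatticePoly K))
    (f₂ := (rename ((fun j : ℤ => (n, m + j)) ∘ Prod.snd) : LatticePoly K →ₐ[K] LatticePoly K))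
    ?_ ?_ rfl
  · ext a
    simp
  · intro v hv _
    have h0 := (mem_supported.mp (hierarchySum_mem_supported k 0 0) hv).1
    simp [latticeShift, h0, add_comm]

end Symmetry

end

theorem mainTheorem1 {K : Type*} [Field K] [CharZero K] (β : K) (hβ : β ≠ 0)
    (k : ℕ) (hk : 1 ≤ k) :
    IsGeneralizedSymmetryM (discreteEq β)
      (fun n m => MvPolynomial.C (β ^ (n * (k : ℤ))) * hierarchySum K k n m) k ∧
    IsAutonomous (hierarchySum K k) := by
  obtain ⟨k, rfl⟩ : ∃ l, k = l + 1 := ⟨k - 1, by omega⟩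
  -- At n = 0 the multiplier is 1.
  have extreme : ∀ s : ℤ, s = 1 ∨ s = -1 → pderiv (0, 0 + s * ((k + 1 : ℕ) : ℤ))
      (C (β ^ ((0 : ℤ) * ((k + 1 : ℕ) : ℤ))) * hierarchySum K (k + 1) 0 0) ≠ 0 := by
    intro s hs h0
    obtain ⟨a, ha, h⟩ := eval_zero_pderiv_hierarchySum (K := K) hs k
    apply ha
    rw [← h 0 0]
    rw [zero_mul, zpow_zero, C_1, one_mul] at h0
    rw [h0, map_zero]
  refine ⟨⟨hk, fun n m v hv => ?_, ⟨0, 0, ?_⟩, ⟨0, 0, ?_⟩,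
    compatible_hierarchySum β hβ k⟩, isAutonomous_hierarchySum k⟩
  · exact mem_supported.mp (mul_mem (Subalgebra.algebraMap_mem _ _)
      (hierarchySum_mem_supported k n m)) hv
  · simpa only [one_mul] using extreme 1 (Or.inl rfl)
  · simpa only [neg_mul, one_mul, ← sub_eq_add_neg] using extreme (-1) (Or.inr rfl)
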